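/- Fix a prime number $p$. All rings are commutative with $1$. Let $R_0\xrightarrow{t_0}R_1\xrightarrow{t_1}R_2\to\cdots$ be a tower of rings and $I_0\subseteq R_0$ an ideal; put $\overline{R_i}=R_i/I_0R_i$, let $\overline{t_i}\colon\overline{R_i}\to\overline{R_{i+1}}$ be the map induced by $t_i$, and let $(R_i)_{I_0\text{-tor}}$ be the ideal of all $m\in R_i$ such that for every $x\in I_0$ there is $n>0$ with $x^nm=0$. The tower is called a *perfectoid tower arising from $(R_0,I_0)$* if the following hold. (a) $p\in I_0$. (b) $\overline{t_i}$ is injective for every $i\ge 0$. (c) For every $i\ge 0$, the image of the Frobenius endomorphism of $\overline{R_{i+1}}$ is contained in the image of $\overline{t_i}$. By (b), there is then a unique ring map $F_i\colon\overline{R_{i+1}}\to\overline{R_i}$ such that $\overline{t_i}(F_i(x))=x^p$ for all $x$. (d) $F_i$ is surjective for every $i\ge 0$. (e) $I_0R_i$ is contained in the Jacobson radical of $R_i$ for every $i\ge 0$. (f) $I_0$ is principal, and there is a principal ideal $I_1\subseteq R_1$ such that $I_1^p=I_0R_1$ and $\ker(F_i)=I_1\overline{R_{i+1}}$ for every $i\ge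 0$. (g) For every $i\ge 0$, $I_0\cdot(R_i)_{I_0\text{-tor}}=0$, and there is a bijection $(R_{i+1})_{I_0\text{-tor}}\to(R_i)_{I_0\text{-tor}}$ that is compatible with $F_i$ via the natural maps $(R_j)_{I_0\text{-tor}}\to\overline{R_j}$ for $j=i+1,i$. A ring $S$ is called *perfectoid* (in the sense of Bhatt–Morrow–Scholze) if (1) $S$ is $\varpi$-adically complete and separated for some $\varpi\in S$ such that $\varpi^p$ divides $p$; (2) the Frobenius endomorphism of $S/pS$ is surjective; and (3) the kernel of Fontaine's map $\theta_S\colon W(S^\flat)\to S$ is principal, where $S^\flat$ is the inverse limit of $\cdots\to S/pS\to S/pS$ along Frobenius, and $W$ denotes $p$-typical Witt vectors. **Corollary.** Let $(\{R_i\}_{i\ge 0},\{t_i\}_{i\ge 0})$ be a perfectoid tower arising from $(R_0,I_0)$, let $I_1\subseteq R_1$ be an ideal as in (f), and let $R_\infty=\varinjlim_i R_i$. Then the $I_1R_\infty$-adic completion $\varprojlim_n R_\infty/I_1^nR_\infty$ of $R_\infty$ is a perfectoid ring. -/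

import Mathlib

universe u v

noncomputable section

/-- For a ring map `f : A → B` and an ideal `I` of `A`, the elements `b` of `B` that are
`I`-torsion: for every `x ∈ I` some positive power of `x` kills `b`. They form an ideal of `B`. -/
def idealTorsion {A : Type u} {B : Type v} [CommRing A] [CommRing B] (f : A →+* B) (I : Ideal A) :
    Ideal B where
  carrier := {b | ∀ x ∈ I, ∃ n : ℕ, 0 < n ∧ f x ^ n * b = 0}
  zero_mem' := fun _ _ => ⟨1, one_pos, mul_zero _⟩
  add_mem' := by
    intro a b ha hb x hx
    obtain ⟨n, hn, hna⟩ := ha x hx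
    obtain ⟨m, -, hmb⟩ := hb x hx
    refine ⟨n + m, by omega, ?_⟩
    rw [pow_add]
    linear_combination f x ^ m * hna + f x ^ n * hmb
  smul_mem' := by
    intro c b hb x hx
    obtain ⟨n, hn, hnb⟩ := hb x hx
    refine ⟨n, hn, ?_⟩
    rw [smul_eq_mul]
    linear_combination c * hnb

/-- A ring `S` is perfectoid (in the sense of Bhatt, Morrow and Scholze). -/
structure IsPerfectoidRing (p : ℕ) [Fact p.Prime] (S : Type u) [CommRing S] : Prop where
  /-- `S` is `ϖ`-adically complete and separated for some `ϖ` such that `ϖ ^ p` divides `p`. -/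
  exists_isAdicComplete : ∃ ϖ : S, ϖ ^ p ∣ (p : S) ∧ IsAdicComplete (Ideal.span {ϖ}) S
  /-- The Frobenius endomorphism of `S / pS` is surjective. -/
  frobenius_surjective :
    Function.Surjective (fun x : S ⧸ Ideal.span {(p : S)} => x ^ p)
  /-- The kernel of Fontaine's map `θ : W(S♭) → S` is principal. The map `θ` is defined for a
  `p`-adically complete ring. Mathlib's `θ` also asks that `p` is not a unit; when `p` is a unit,
  completeness forces `S = 0`, so that `W(S♭) = 0` and there is nothing to require. -/
  ker_theta_isPrincipal : ∀ [Fact (¬ IsUnit (p : S))],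
    ∃ _ : IsAdicComplete (Ideal.span {(p : S)}) S,
      (RingHom.ker (WittVector.fontaineTheta S p)).IsPrincipal

namespace Tower

/-! A tower of rings `R 0 → R 1 → R 2 → ⋯` is given by the rings `R i` and the ring maps
`t i : R i → R (i + 1)`. -/

variable {R : ℕ → Type u} [∀ i, CommRing (R i)]

/-- The composite transition map `R i → R j` for `i ≤ j`. -/
def trans (t : ∀ i, R i →+* R (i + 1)) (i j : ℕ) (h : i ≤ j) : R i →+* R j :=
  Nat.leRec (motive := fun k _ => R i →+* R k) (RingHom.id (R i))
    (fun k _ g => (t k).comp g) h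

theorem trans_self (t : ∀ i, R i →+* R (i + 1)) (i : ℕ) :
    trans t i i le_rfl = RingHom.id (R i) := by
  simp [trans]

theorem trans_succ (t : ∀ i, R i →+* R (i + 1)) (i j : ℕ) (h : i ≤ j) :
    trans t i (j + 1) (h.trans j.le_succ) = (t j).comp (trans t i j h) := by
  simp [trans, Nat.leRec_succ _ _ h]

theorem trans_trans (t : ∀ i, R i →+* R (i + 1)) (i j k : ℕ) (h : i ≤ j) (h' : j ≤ k) :
    (trans t j k h').comp (trans t i j h) = trans t i k (h.trans h') := by
  induction k, h' using Nat.le_induction with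
  | base => rw [trans_self, RingHom.id_comp]
  | succ k hk ih => rw [trans_succ t j k hk, RingHom.comp_assoc, ih, trans_succ t i k (h.trans hk)]

instance directedSystem (t : ∀ i, R i →+* R (i + 1)) :
    DirectedSystem R (fun i j h => trans t i j h) where
  map_self i x := by rw [trans_self]; rfl
  map_map i j k h h' x := by rw [← trans_trans t k j i h h']; rfl

/-- The direct limit `R_∞` of the tower. -/
abbrev Limit (t : ∀ i, R i →+* R (i + 1)) : Type u :=
  Ring.DirectLimit R (fun i j h => trans t i j h)

/-- The canonical map `R i → R_∞`. -/
abbrev toLimit (t : ∀ i, R i →+* R (i + 1)) (i : ℕ) : R i →+* Limit t :=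
  Ring.DirectLimit.of R (fun i j h => trans t i j h) i

/-- The ideal `I R_i` of `R i`, for an ideal `I` of `R 0`. -/
abbrev ext (t : ∀ i, R i →+* R (i + 1)) (I : Ideal (R 0)) (i : ℕ) : Ideal (R i) :=
  I.map (trans t 0 i i.zero_le)

theorem ext_le_comap (t : ∀ i, R i →+* R (i + 1)) (I : Ideal (R 0)) (i : ℕ) :
    ext t I i ≤ (ext t I (i + 1)).comap (t i) := by
  rw [← Ideal.map_le_iff_le_comap, Ideal.map_map, ← trans_succ]

/-- The map `R_i / I R_i → R_{i+1} / I R_{i+1}` induced by `t i`. -/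
def tbar (t : ∀ i, R i →+* R (i + 1)) (I : Ideal (R 0)) (i : ℕ) :
    R i ⧸ ext t I i →+* R (i + 1) ⧸ ext t I (i + 1) :=
  Ideal.quotientMap (ext t I (i + 1)) (t i) (ext_le_comap t I i)

/-- The tower is a `p`-purely inseparable tower arising from `(R 0, I)`. -/
structure IsPurelyInseparable (p : ℕ) (t : ∀ i, R i →+* R (i + 1)) (I : Ideal (R 0)) : Prop where
  /-- Axiom (a). -/
  p_mem : (p : R 0) ∈ I
  /-- Axiom (b). -/
  tbar_injective : ∀ i, Function.Injective (tbar t I i)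
  /-- Axiom (c): the image of Frobenius is contained in the image of `tbar`. -/
  pow_mem_range : ∀ i (x : R (i + 1) ⧸ ext t I (i + 1)), ∃ y, tbar t I i y = x ^ p

section

variable {p : ℕ} {t : ∀ i, R i →+* R (i + 1)} {I : Ideal (R 0)}

theorem IsPurelyInseparable.cast_eq_zero (h : IsPurelyInseparable p t I) (i : ℕ) :
    (p : R i ⧸ ext t I i) = 0 := by
  rw [← map_natCast (Ideal.Quotient.mk (ext t I i)), Ideal.Quotient.eq_zero_iff_mem,
    ← map_natCast (trans t 0 i i.zero_le)]
  exact Ideal.mem_map_of_mem _ h.p_mem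

/-- The `i`-th Frobenius projection: the unique ring map `F_i : R_{i+1}/I R_{i+1} → R_i/I R_i`
such that `tbar i (F_i x) = x ^ p` for all `x`. -/
def frobProj [Fact p.Prime] (h : IsPurelyInseparable p t I) (i : ℕ) :
    R (i + 1) ⧸ ext t I (i + 1) →+* R i ⧸ ext t I i where
  toFun x := (h.pow_mem_range i x).choose
  map_one' := h.tbar_injective i (by
    rw [(h.pow_mem_range i 1).choose_spec, map_one, one_pow])
  map_mul' x y := h.tbar_injective i (by
    rw [map_mul, (h.pow_mem_range i _).choose_spec, (h.pow_mem_range i x).choose_spec,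
      (h.pow_mem_range i y).choose_spec, mul_pow])
  map_zero' := h.tbar_injective i (by
    rw [(h.pow_mem_range i 0).choose_spec, map_zero, zero_pow (Fact.out : p.Prime).ne_zero])
  map_add' x y := h.tbar_injective i (by
    rw [map_add, (h.pow_mem_range i _).choose_spec, (h.pow_mem_range i x).choose_spec,
      (h.pow_mem_range i y).choose_spec]
    obtain ⟨r, hr⟩ := exists_add_pow_prime_eq (Fact.out : p.Prime) x y
    rw [hr, h.cast_eq_zero (i + 1)]
    ring)

theorem tbar_frobProj [Fact p.Prime] (h : IsPurelyInseparable p t I) (i : ℕ)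
    (x : R (i + 1) ⧸ ext t I (i + 1)) : tbar t I i (frobProj h i x) = x ^ p :=
  (h.pow_mem_range i x).choose_spec

/-- `I₁` is the first perfectoid pillar: a principal ideal of `R 1` with `I₁ ^ p = I R_1` and
`ker F_i = I₁ (R_{i+1} / I R_{i+1})` for all `i`. (This is axiom (f), apart from the principality
of `I`.) -/
structure IsFirstPillar [Fact p.Prime] (h : IsPurelyInseparable p t I) (I₁ : Ideal (R 1)) :
    Prop where
  isPrincipal : I₁.IsPrincipal
  /-- Axiom (f-1). -/
  pow_eq : I₁ ^ p = ext t I 1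
  /-- Axiom (f-2). -/
  ker_frobProj : ∀ i, RingHom.ker (frobProj h i) =
    I₁.map ((Ideal.Quotient.mk (ext t I (i + 1))).comp (trans t 1 (i + 1) i.succ_pos))

end

/-- The tower is a `p`-perfectoid tower arising from `(R 0, I)`. -/
structure IsPerfectoid (p : ℕ) [Fact p.Prime] (t : ∀ i, R i →+* R (i + 1)) (I : Ideal (R 0)) :
    Prop where
  /-- Axioms (a), (b) and (c). -/
  purelyInseparable : IsPurelyInseparable p t I
  /-- Axiom (d). -/
  frobProj_surjective : ∀ i, Function.Surjective (frobProj purelyInseparable i)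
  /-- Axiom (e): `R i` is `I`-adically Zariskian. -/
  zariskian : ∀ i, ext t I i ≤ Ideal.jacobson ⊥
  /-- Axiom (f). -/
  isPrincipal : I.IsPrincipal
  /-- Axiom (f), continued. -/
  exists_pillar : ∃ I₁ : Ideal (R 1), IsFirstPillar purelyInseparable I₁
  /-- Axiom (g), first part. -/
  mul_torsion : ∀ i, ext t I i * idealTorsion (trans t 0 i i.zero_le) I = ⊥
  /-- Axiom (g), second part: `F_i` lifts to a bijection between the torsion parts. -/
  exists_torsion_bijection : ∀ i,
    ∃ G : idealTorsion (trans t 0 (i + 1) (i + 1).zero_le) I →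
        idealTorsion (trans t 0 i i.zero_le) I,
      Function.Bijective G ∧
        ∀ x, Ideal.Quotient.mk (ext t I i) (G x) =
          frobProj purelyInseparable i (Ideal.Quotient.mk (ext t I (i + 1)) x)

end Tower

end

/-! Let g and f generate I₀ and I₁, and let ϖ be the image of f in R_∞; there ϖ^p and g divide each
other. The F_i become Frobenius in the limit, so their surjectivity and their kernels say that
Frobenius induces R_∞/ϖ ≅ R_∞/ϖ^p. The bijections of axiom (g) make Frobenius bijective on the
torsion, which ϖ kills (`isPrePerfectoid_limit`). Completion preserves the quotients by powers of ϖ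
and the torsion, hence all of this (`of_forall_quotient`).

In a ϖ-complete S with these properties, ϖ can be changed by a unit into π♯ with π in the tilt. Then
θ is surjective, p = π♯θ(x), and ξ = p - [π]x generates ker θ. Indeed a in ker θ has the form ξc +
[π]d, so π♯θ(d) = 0. The obstruction to iterating is that θ(d) may be nonzero torsion; but θ(d) = τ♯
for some τ with πτ = 0, and d - [τ] serves instead of d (`exists_eq_add_teichmuller_mul`). The
iteration converges because S♭ is π-complete (`isAdicComplete_preTilt`). Both steps rest on π
generating the kernel of S♭ → S/ϖ (`dvd_of_untilt_dvd_untilt`). -/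

/-! ### Completeness along a principal ideal. -/

section AdicallyComplete

variable {S : Type*} [CommRing S]

theorem sModEq_span_singleton_pow_iff (ϖ a b : S) (n : ℕ) :
    a ≡ b [SMOD (Ideal.span {ϖ} ^ n • ⊤ : Ideal S)] ↔ ϖ ^ n ∣ a - b := by
  rw [SModEq.sub_mem, smul_eq_mul, Ideal.mul_top, Ideal.span_singleton_pow,
    Ideal.mem_span_singleton]

theorem isAdicComplete_span_singleton_iff (ϖ : S) :
    IsAdicComplete (Ideal.span {ϖ}) S ↔ (∀ x : S, (∀ n, ϖ ^ n ∣ x) → x = 0) ∧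
      ∀ f : ℕ → S, (∀ n, ϖ ^ n ∣ f (n + 1) - f n) → ∃ L, ∀ n, ϖ ^ n ∣ L - f n := by
  rw [isAdicComplete_iff, isHausdorff_iff, isPrecomplete_iff]
  simp only [sModEq_span_singleton_pow_iff, sub_zero]
  refine and_congr_right fun _ => ⟨fun h f hf => ?_, fun h f hf => ?_⟩
  · obtain ⟨L, hL⟩ := h f (fun {m n} hmn => by
      induction n, hmn using Nat.le_induction with
      | base => simp
      | succ n hmn ih =>
        have := dvd_add ih (((pow_dvd_pow ϖ hmn).trans (hf n)).neg_right)
        rwa [neg_sub, sub_add_sub_cancel] at this)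
    exact ⟨L, fun n => by rw [dvd_sub_comm]; exact hL n⟩
  · obtain ⟨L, hL⟩ := h f fun n => by rw [dvd_sub_comm]; exact hf n.le_succ
    exact ⟨L, fun n => by rw [dvd_sub_comm]; exact hL n⟩

variable {ϖ : S} [IsAdicComplete (Ideal.span {ϖ}) S]

theorem eq_zero_of_forall_pow_dvd (ϖ : S) [IsAdicComplete (Ideal.span {ϖ}) S] {x : S}
    (h : ∀ n, ϖ ^ n ∣ x) : x = 0 :=
  ((isAdicComplete_span_singleton_iff ϖ).1 ‹_›).1 x h

theorem exists_limit_of_pow_dvd (f : ℕ → S) (h : ∀ n, ϖ ^ n ∣ f (n + 1) - f n) :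
    ∃ L, ∀ n, ϖ ^ n ∣ L - f n :=
  ((isAdicComplete_span_singleton_iff ϖ).1 ‹_›).2 f h

theorem exists_series_limit (ϖ : S) [IsAdicComplete (Ideal.span {ϖ}) S] (c : ℕ → S) :
    ∃ L, ∀ n, ϖ ^ n ∣ L - ∑ k ∈ Finset.range n, ϖ ^ k * c k :=
  exists_limit_of_pow_dvd _ fun n => by simp [Finset.sum_range_succ]

/-- The tail of a q-Cauchy sequence from index n on is q^n times a ϖ-adically convergent series, so
q^n divides the difference to the ϖ-adic limit exactly. -/
theorem isAdicComplete_span_singleton_of_dvd {q : S} (h : ϖ ∣ q) :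
    IsAdicComplete (Ideal.span {q}) S := by
  refine (isAdicComplete_span_singleton_iff q).2
    ⟨fun x hx => eq_zero_of_forall_pow_dvd ϖ fun n => (pow_dvd_pow_of_dvd h n).trans (hx n),
      fun f hf => ?_⟩
  obtain ⟨L, hL⟩ := exists_limit_of_pow_dvd (ϖ := ϖ) f
    fun n => (pow_dvd_pow_of_dvd h n).trans (hf n)
  choose c hc using hf
  obtain ⟨e, he⟩ := h
  refine ⟨L, fun n => ?_⟩
  obtain ⟨t, ht⟩ := exists_series_limit ϖ fun k => e ^ k * c (n + k)
  have tail (k : ℕ) : f (n + k) - f n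
      = q ^ n * ∑ j ∈ Finset.range k, ϖ ^ j * (e ^ j * c (n + j)) := by
    induction k with
    | zero => simp
    | succ k ih =>
      rw [Finset.sum_range_succ, mul_add, ← ih, ← mul_assoc (ϖ ^ k), ← mul_pow, ← he,
        ← mul_assoc, ← pow_add, ← hc (n + k)]
      ring_nf
  refine ⟨t, sub_eq_zero.1 (eq_zero_of_forall_pow_dvd ϖ fun k => ?_)⟩
  have h1 := (pow_dvd_pow ϖ (Nat.le_add_left k n)).trans (hL (n + k))
  have h2 := (ht k).mul_left (q ^ n)
  convert dvd_sub h1 h2 using 1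
  linear_combination tail k

theorem isUnit_one_add_mul (x : S) : IsUnit (1 + ϖ * x) := by
  have h := IsAdicComplete.le_jacobson_bot (Ideal.span {ϖ}) (Ideal.mem_span_singleton_self ϖ)
  rw [Ideal.mem_jacobson_bot] at h
  rw [add_comm]
  exact h x

/-- If every element is a `p`-th power modulo `ϖ ^ p`, then every element is one modulo `p`. -/
theorem exists_dvd_sub_pow_of_pow_dvd {p : ℕ} (hp : p.Prime)
    (h : ∀ a : S, ∃ b, ϖ ^ p ∣ a - b ^ p) (a : S) : ∃ b, (p : S) ∣ a - b ^ p := by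
  choose r hr using h
  choose d hd using hr
  -- Digit expansion: a = ∑ ϖ^(pk) r(x_k)^p. It differs from the p-th power of ∑ ϖ^k r(x_k) by p
  -- times the convergent series ∑ ϖ^k w_k of cross terms.
  let x : ℕ → S := fun n => Nat.rec a (fun _ z => d z) n
  have hx (n : ℕ) : x n = r (x n) ^ p + ϖ ^ p * x (n + 1) := by
    linear_combination hd (x n)
  let s : ℕ → S := fun n => ∑ k ∈ Finset.range n, ϖ ^ k * r (x k)
  have hs (n : ℕ) : s (n + 1) = s n + ϖ ^ n * r (x n) := Finset.sum_range_succ _ _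
  have key (n : ℕ) : ∃ w, s (n + 1) ^ p = s n ^ p + (ϖ ^ n * r (x n)) ^ p + p * (ϖ ^ n * w) := by
    obtain ⟨w, hw⟩ := exists_add_pow_prime_eq hp (s n) (ϖ ^ n * r (x n))
    exact ⟨s n * r (x n) * w, by rw [hs, hw]; ring⟩
  choose w hw using key
  have hsum (n : ℕ) : a - s n ^ p =
      ϖ ^ (n * p) * x n - p * ∑ k ∈ Finset.range n, ϖ ^ k * w k := by
    induction n with
    | zero => simp [s, hp.ne_zero, x]
    | succ n ih =>
      rw [Finset.sum_range_succ, hw]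
      have e : (ϖ ^ n * r (x n)) ^ p = ϖ ^ (n * p) * r (x n) ^ p := by rw [mul_pow, pow_mul]
      have e' : ϖ ^ ((n + 1) * p) = ϖ ^ (n * p) * ϖ ^ p := by rw [← pow_add]; ring_nf
      rw [e, e']
      linear_combination ih + ϖ ^ (n * p) * hx n
  obtain ⟨b, hb⟩ := exists_series_limit ϖ fun k => r (x k)
  obtain ⟨D, hD⟩ := exists_series_limit ϖ w
  refine ⟨b, -D, sub_eq_zero.1 (eq_zero_of_forall_pow_dvd ϖ fun n => ?_)⟩
  have h1 : ϖ ^ n ∣ b ^ p - s n ^ p := (hb n).trans (sub_dvd_pow_sub_pow _ _ _)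
  have h2 : ϖ ^ n ∣ ϖ ^ (n * p) * x n :=
    (pow_dvd_pow ϖ (Nat.le_mul_of_pos_right n hp.pos)).mul_right _
  have h3 := (hD n).mul_left (p : S)
  convert dvd_add (dvd_sub h2 h1) h3 using 1
  linear_combination hsum n

end AdicallyComplete

/-! ### Pre-perfectoid elements and completion. -/

/-- The conditions on a ring `A` and an element `ϖ` that make the `ϖ`-adic completion of `A` a
perfectoid ring: the Frobenius map induces an isomorphism `A / ϖ ≃ A / ϖ ^ p`, and it is bijective
on the `ϖ`-power torsion of `A`, which is killed by `ϖ`. -/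
structure IsPrePerfectoid (p : ℕ) {A : Type*} [CommRing A] (ϖ : A) : Prop where
  pow_dvd : ϖ ^ p ∣ (p : A)
  exists_dvd_sub_pow : ∀ a : A, ∃ b, ϖ ^ p ∣ a - b ^ p
  dvd_of_pow_dvd_pow : ∀ a : A, ϖ ^ p ∣ a ^ p → ϖ ∣ a
  mul_eq_zero_of_sq : ∀ a : A, ϖ ^ 2 * a = 0 → ϖ * a = 0
  exists_torsion_root : ∀ a : A, ϖ * a = 0 → ∃ b, ϖ * b = 0 ∧ b ^ p = a
  torsion_reduced : ∀ a : A, ϖ * a = 0 → a ^ p = 0 → a = 0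

namespace IsPrePerfectoid

variable {p : ℕ} {A : Type*} [CommRing A] {ϖ : A}

theorem of_associated {ϖ' : A} (h : IsPrePerfectoid p ϖ) (ha : Associated ϖ ϖ') :
    IsPrePerfectoid p ϖ' := by
  have hp := ha.pow_pow (n := p)
  have h0 (n : ℕ) (a : A) : ϖ' ^ n * a = 0 ↔ ϖ ^ n * a = 0 := by
    obtain ⟨u, hu⟩ := ha.pow_pow (n := n)
    rw [← hu, mul_right_comm, Units.mul_left_eq_zero]
  have h1 (a : A) : ϖ' * a = 0 ↔ ϖ * a = 0 := by simpa using h0 1 a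
  refine ⟨hp.dvd_iff_dvd_left.1 h.pow_dvd, fun a => ?_, fun a => ?_, fun a => ?_, fun a => ?_,
    fun a => ?_⟩
  · obtain ⟨b, hb⟩ := h.exists_dvd_sub_pow a
    exact ⟨b, hp.dvd_iff_dvd_left.1 hb⟩
  · rw [← hp.dvd_iff_dvd_left, ← ha.dvd_iff_dvd_left]
    exact h.dvd_of_pow_dvd_pow a
  · rw [h0, h1]
    exact h.mul_eq_zero_of_sq a
  · simpa only [h1] using h.exists_torsion_root a
  · rw [h1]
    exact h.torsion_reduced a

/-- The conditions pass to a separated ring `S` with `A / ϖ ^ n ≃ S / ϖ ^ n` for all `n`. -/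
theorem of_forall_quotient {S : Type*} [CommRing S] (hp : p ≠ 0)
    (h : IsPrePerfectoid p ϖ) (φ : A →+* S)
    (hsep : ∀ x : S, (∀ n, φ ϖ ^ n ∣ x) → x = 0)
    (hinj : ∀ (n : ℕ) (a : A), φ ϖ ^ n ∣ φ a → ϖ ^ n ∣ a)
    (hsurj : ∀ (n : ℕ) (x : S), ∃ a, φ ϖ ^ n ∣ x - φ a) : IsPrePerfectoid p (φ ϖ) := by
  have hmap {n : ℕ} {a : A} (ha : ϖ ^ n ∣ a) : φ ϖ ^ n ∣ φ a := by
    simpa using map_dvd φ ha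
  have tors_dvd (a : A) (ha : ϖ * a = 0) (hd : ϖ ∣ a) : a = 0 := by
    obtain ⟨c, rfl⟩ := hd
    exact h.mul_eq_zero_of_sq c (by rw [← ha]; ring)
  have sq_approx (x : S) (hx : φ ϖ ^ 2 * x = 0) (n : ℕ) :
      ∃ a, ϖ * a = 0 ∧ φ ϖ ^ (n + 1) ∣ x - φ a := by
    -- Multiplying by ϖ² raises the precision to n + 3; the multiple of ϖ^(n+1) then subtracted from
    -- a makes it exactly torsion.
    obtain ⟨a, y, hy⟩ := hsurj (n + 1) x
    obtain ⟨c, hc⟩ := hinj (n + 3) (ϖ ^ 2 * a) ⟨-y, by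
      rw [map_mul, map_pow]
      linear_combination hx - φ ϖ ^ 2 * hy⟩
    refine ⟨a - ϖ ^ (n + 1) * c, h.mul_eq_zero_of_sq _ (by linear_combination hc), y + φ c, ?_⟩
    rw [map_sub, map_mul, map_pow]
    linear_combination hy
  have sq (x : S) (hx : φ ϖ ^ 2 * x = 0) : φ ϖ * x = 0 := by
    refine hsep _ fun n => ?_
    obtain ⟨a, ha, c, hc⟩ := sq_approx x hx n
    have ha' : φ ϖ * φ a = 0 := by rw [← map_mul, ha, map_zero]
    exact ⟨φ ϖ ^ 2 * c, by linear_combination φ ϖ * hc + ha'⟩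
  -- The torsion approximations of x agree modulo ϖ, hence are equal, since no nonzero torsion
  -- element of A is a multiple of ϖ.
  have tors (x : S) (hx : φ ϖ * x = 0) : ∃ a, ϖ * a = 0 ∧ φ a = x := by
    choose a ha hxa using sq_approx x (by rw [pow_two, mul_assoc, hx, mul_zero])
    have hconst (n : ℕ) : a n = a 0 := by
      refine sub_eq_zero.1 (tors_dvd _ (by rw [mul_sub, ha, ha, sub_zero]) ?_)
      have h1 := (pow_dvd_pow (φ ϖ) (Nat.le_add_left 1 n)).trans (hxa n)
      have h2 := dvd_sub (hxa 0) h1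
      rw [zero_add, sub_sub_sub_cancel_left, ← map_sub] at h2
      simpa using hinj 1 _ h2
    refine ⟨a 0, ha 0, (sub_eq_zero.1 (hsep _ fun n => ?_)).symm⟩
    have := hxa n
    rw [hconst] at this
    exact (pow_dvd_pow _ n.le_succ).trans this
  refine ⟨by simpa using hmap h.pow_dvd, fun x => ?_, fun x hx => ?_, sq, fun x hx => ?_,
    fun x hx hxp => ?_⟩
  · obtain ⟨a, ha⟩ := hsurj p x
    obtain ⟨b, hb⟩ := h.exists_dvd_sub_pow a
    refine ⟨φ b, ?_⟩
    have := dvd_add ha (hmap hb)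
    rwa [map_sub, map_pow, sub_add_sub_cancel] at this
  · obtain ⟨a, ha⟩ := hsurj (p + 1) x
    have h1 : φ ϖ ^ p ∣ x ^ p - φ (a ^ p) := by
      rw [map_pow]
      exact ((pow_dvd_pow _ p.le_succ).trans ha).trans (sub_dvd_pow_sub_pow _ _ _)
    have h2 := h.dvd_of_pow_dvd_pow a (hinj p _ ((dvd_iff_dvd_of_dvd_sub h1).1 hx))
    have h3 : φ ϖ ∣ x - φ a := (dvd_pow_self _ p.succ_ne_zero).trans ha
    exact (dvd_iff_dvd_of_dvd_sub h3).2 (map_dvd φ h2)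
  · obtain ⟨a, ha, rfl⟩ := tors x hx
    obtain ⟨b, hb, rfl⟩ := h.exists_torsion_root a ha
    exact ⟨φ b, by rw [← map_mul, hb, map_zero], by rw [map_pow]⟩
  · obtain ⟨a, ha, rfl⟩ := tors x hx
    rw [← map_pow] at hxp
    have hap : a ^ p = 0 := by
      refine tors_dvd _ ?_ (by simpa using hinj 1 _ (by rw [hxp]; exact dvd_zero _))
      obtain ⟨q, rfl⟩ := Nat.exists_eq_succ_of_ne_zero hp
      rw [pow_succ', ← mul_assoc, ha, zero_mul]
    rw [h.torsion_reduced a ha hap, map_zero]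

end IsPrePerfectoid

theorem isAdicComplete_adicCompletion {A : Type*} [CommRing A] (ϖ : A) :
    IsAdicComplete (Ideal.span {algebraMap A (AdicCompletion (Ideal.span {ϖ}) A) ϖ})
      (AdicCompletion (Ideal.span {ϖ}) A) := by
  have h := AdicCompletion.isAdicComplete (M := A)
    (Submodule.fg_span_singleton ϖ : (Ideal.span {ϖ}).FG)
  have e : (Ideal.span {ϖ}).map (algebraMap A (AdicCompletion (Ideal.span {ϖ}) A)) =
      Ideal.span {algebraMap A (AdicCompletion (Ideal.span {ϖ}) A) ϖ} := by
    rw [Ideal.map_span, Set.image_singleton]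
  rw [← e, isAdicComplete_iff, IsHausdorff.map_algebraMap_iff, IsPrecomplete.map_algebraMap_iff]
  exact ⟨h.1, h.2⟩

theorem IsPrePerfectoid.adicCompletion {p : ℕ} (hp : p ≠ 0) {A : Type*} [CommRing A] {ϖ : A}
    (h : IsPrePerfectoid p ϖ) :
    IsPrePerfectoid p (algebraMap A (AdicCompletion (Ideal.span {ϖ}) A) ϖ) := by
  have := isAdicComplete_adicCompletion ϖ
  have hev (n : ℕ) (a : A) : AdicCompletion.evalₐ (Ideal.span {ϖ}) n
      (algebraMap A (AdicCompletion (Ideal.span {ϖ}) A) a) = Ideal.Quotient.mk _ a :=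
    AdicCompletion.evalₐ_of _ n a
  refine h.of_forall_quotient hp _ (fun x => eq_zero_of_forall_pow_dvd _) (fun n a ha => ?_)
    (fun n x => ?_)
  · have h1 := map_dvd (AdicCompletion.evalₐ (Ideal.span {ϖ}) n) ha
    have h0 : Ideal.Quotient.mk (Ideal.span {ϖ} ^ n) (ϖ ^ n) = 0 :=
      Ideal.Quotient.eq_zero_iff_mem.2 (Ideal.pow_mem_pow (Ideal.mem_span_singleton_self ϖ) n)
    rw [map_pow, hev, hev, ← map_pow, h0, zero_dvd_iff, Ideal.Quotient.eq_zero_iff_mem,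
      Ideal.span_singleton_pow, Ideal.mem_span_singleton] at h1
    exact h1
  · obtain ⟨a, ha⟩ := Ideal.Quotient.mk_surjective (AdicCompletion.evalₐ (Ideal.span {ϖ}) n x)
    refine ⟨a, ?_⟩
    have h0 : x - algebraMap A _ a ∈ (AdicCompletion.eval (Ideal.span {ϖ}) A n).ker := by
      refine LinearMap.mem_ker.2
        ((AdicCompletion.factor_evalₐ_eq_eval (Ideal.span {ϖ}) _ (by simp)).symm.trans ?_)
      rw [map_sub, hev, ha, sub_self, map_zero]
    rw [← AdicCompletion.pow_smul_top_eq_ker_eval (M := A) (Submodule.fg_span_singleton ϖ),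
      Ideal.span_singleton_pow, Submodule.ideal_span_singleton_smul,
      Submodule.mem_smul_pointwise_iff_exists] at h0
    obtain ⟨y, -, hy⟩ := h0
    exact ⟨y, by rw [← hy, Algebra.smul_def, map_pow]⟩

/-! ### The direct limit of a perfectoid tower. -/

namespace Tower

variable {R : ℕ → Type u} [∀ i, CommRing (R i)] {t : ∀ i, R i →+* R (i + 1)}

theorem toLimit_trans (i j : ℕ) (hij : i ≤ j) (x : R i) :
    toLimit t j (trans t i j hij x) = toLimit t i x :=
  Ring.DirectLimit.of_f _ _

theorem toLimit_succ (i : ℕ) (x : R i) : toLimit t (i + 1) (t i x) = toLimit t i x := by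
  rw [← toLimit_trans i (i + 1) i.le_succ, trans_succ t i i le_rfl, trans_self]
  rfl

theorem trans_trans_apply {i j k : ℕ} (hij : i ≤ j) (hjk : j ≤ k) (x : R i) :
    trans t j k hjk (trans t i j hij x) = trans t i k (hij.trans hjk) x :=
  DFunLike.congr_fun (trans_trans t i j k hij hjk) x

theorem exists_toLimit_eq (z : Limit t) (k : ℕ) : ∃ i, k ≤ i ∧ ∃ x, toLimit t i x = z := by
  obtain ⟨i, x, rfl⟩ := Ring.DirectLimit.exists_of z
  exact ⟨max k i, le_max_left _ _, trans t i _ (le_max_right _ _) x, toLimit_trans _ _ _ _⟩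

theorem exists_trans_eq_zero {i : ℕ} {x : R i} (hx : toLimit t i x = 0) :
    ∃ j, ∃ hij : i ≤ j, trans t i j hij x = 0 :=
  Ring.DirectLimit.of.zero_exact (f' := fun i j h => trans t i j h) hx

section

variable {p : ℕ} {g : R 0}

theorem mem_ext_span_iff (i : ℕ) (x : R i) :
    x ∈ ext t (Ideal.span {g}) i ↔ trans t 0 i i.zero_le g ∣ x := by
  rw [ext, Ideal.map_span, Set.image_singleton, Ideal.mem_span_singleton]

theorem mk_ext_eq_zero_iff (i : ℕ) (x : R i) :
    Ideal.Quotient.mk (ext t (Ideal.span {g}) i) x = 0 ↔ trans t 0 i i.zero_le g ∣ x := by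
  rw [Ideal.Quotient.eq_zero_iff_mem, mem_ext_span_iff]

theorem tbar_mk (I : Ideal (R 0)) (i : ℕ) (x : R i) :
    tbar t I i (Ideal.Quotient.mk _ x) = Ideal.Quotient.mk _ (t i x) :=
  rfl

namespace IsPurelyInseparable

theorem dvd_of_dvd_trans (h : IsPurelyInseparable p t (Ideal.span {g})) {i j : ℕ} (hij : i ≤ j)
    {x : R i} (hx : trans t 0 j j.zero_le g ∣ trans t i j hij x) : trans t 0 i i.zero_le g ∣ x := by
  induction j, hij using Nat.le_induction with
  | base => simpa [trans_self] using hx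
  | succ j hij ih =>
    refine ih ?_
    rw [← mk_ext_eq_zero_iff, ← map_eq_zero_iff _ (h.tbar_injective j), tbar_mk,
      mk_ext_eq_zero_iff]
    rwa [trans_succ t i j hij] at hx

theorem dvd_toLimit_iff (h : IsPurelyInseparable p t (Ideal.span {g})) (i : ℕ) (x : R i) :
    toLimit t 0 g ∣ toLimit t i x ↔ trans t 0 i i.zero_le g ∣ x := by
  refine ⟨fun ⟨z, hz⟩ => ?_, fun hx => ?_⟩
  · obtain ⟨j, hij, y, rfl⟩ := exists_toLimit_eq z i
    rw [← toLimit_trans i j hij, ← toLimit_trans 0 j j.zero_le, ← map_mul, ← sub_eq_zero,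
      ← map_sub] at hz
    obtain ⟨k, hjk, hk⟩ := exists_trans_eq_zero hz
    rw [map_sub, map_mul, trans_trans_apply, trans_trans_apply, sub_eq_zero] at hk
    exact h.dvd_of_dvd_trans _ ⟨_, hk⟩
  · rw [← toLimit_trans 0 i i.zero_le]
    exact map_dvd _ hx

theorem dvd_sub_pow_of_frobProj_eq [Fact p.Prime] (h : IsPurelyInseparable p t (Ideal.span {g})) {i : ℕ}
    {x : R (i + 1)} {y : R i}
    (hxy : frobProj h i (Ideal.Quotient.mk _ x) = Ideal.Quotient.mk _ y) :
    trans t 0 (i + 1) (i + 1).zero_le g ∣ t i y - x ^ p := by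
  rw [← mk_ext_eq_zero_iff, map_sub, ← tbar_mk, ← hxy, tbar_frobProj, map_pow, sub_self]

end IsPurelyInseparable

variable [Fact p.Prime]

/-- As `tbar` is injective, F_i has the same kernel as the Frobenius of R_{i+1}/gR_{i+1}. -/
theorem IsFirstPillar.dvd_of_dvd_pow {h : IsPurelyInseparable p t (Ideal.span {g})} {f : R 1}
    (h₁ : IsFirstPillar h (Ideal.span {f})) (hf : f ∣ trans t 0 1 zero_le_one g) {i : ℕ}
    {x : R (i + 1)} (hx : trans t 0 (i + 1) (i + 1).zero_le g ∣ x ^ p) :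
    trans t 1 (i + 1) i.succ_pos f ∣ x := by
  have hker : Ideal.Quotient.mk _ x ∈ RingHom.ker (frobProj h i) := by
    rw [RingHom.mem_ker, ← map_eq_zero_iff _ (h.tbar_injective i), tbar_frobProj, ← map_pow,
      mk_ext_eq_zero_iff]
    exact hx
  rw [h₁.ker_frobProj, Ideal.map_span, Set.image_singleton, Ideal.mem_span_singleton] at hker
  obtain ⟨c, hc⟩ := hker
  obtain ⟨c, rfl⟩ := Ideal.Quotient.mk_surjective c
  rw [RingHom.comp_apply, ← map_mul, ← sub_eq_zero, ← map_sub, mk_ext_eq_zero_iff] at hc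
  have hfg : trans t 1 (i + 1) i.succ_pos f ∣ trans t 0 (i + 1) (i + 1).zero_le g := by
    rw [← trans_trans_apply zero_le_one i.succ_pos]
    exact map_dvd _ hf
  exact (dvd_iff_dvd_of_dvd_sub (hfg.trans hc)).2 (dvd_mul_right _ _)

namespace IsPerfectoid

theorem mem_idealTorsion_iff (h : IsPerfectoid p t (Ideal.span {g})) (i : ℕ) (x : R i) :
    x ∈ idealTorsion (trans t 0 i i.zero_le) (Ideal.span {g}) ↔
      trans t 0 i i.zero_le g * x = 0 := by
  refine ⟨fun hx => ?_, fun hx y hy => ⟨1, one_pos, ?_⟩⟩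
  · rw [← Ideal.mem_bot, ← h.mul_torsion i]
    exact Ideal.mul_mem_mul ((mem_ext_span_iff i _).2 dvd_rfl) hx
  · obtain ⟨c, rfl⟩ := Ideal.mem_span_singleton'.1 hy
    rw [pow_one, map_mul, mul_assoc, hx, mul_zero]

theorem mul_eq_zero_of_sq_mul_eq_zero (h : IsPerfectoid p t (Ideal.span {g})) {i : ℕ} {x : R i}
    (hx : trans t 0 i i.zero_le g ^ 2 * x = 0) : trans t 0 i i.zero_le g * x = 0 := by
  rw [← h.mem_idealTorsion_iff]
  intro y hy
  obtain ⟨c, rfl⟩ := Ideal.mem_span_singleton'.1 hy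
  exact ⟨2, two_pos, by rw [map_mul, mul_pow, mul_assoc, hx, mul_zero]⟩

/-- The torsion thus embeds in R_i/gR_i, so congruences modulo g between torsion elements, such as
those supplied by axiom (g), are equalities. -/
theorem eq_zero_of_dvd_of_mul_eq_zero (h : IsPerfectoid p t (Ideal.span {g})) {i : ℕ} {x : R i}
    (hd : trans t 0 i i.zero_le g ∣ x) (hx : trans t 0 i i.zero_le g * x = 0) : x = 0 := by
  obtain ⟨c, rfl⟩ := hd
  exact h.mul_eq_zero_of_sq_mul_eq_zero (by rw [← hx]; ring)

theorem mul_map_eq_zero {i : ℕ} {x : R i} (hx : trans t 0 i i.zero_le g * x = 0) :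
    trans t 0 (i + 1) (i + 1).zero_le g * t i x = 0 := by
  rw [trans_succ t 0 i i.zero_le, RingHom.comp_apply, ← map_mul, hx, map_zero]

theorem exists_pow_eq_of_mul_eq_zero (h : IsPerfectoid p t (Ideal.span {g})) {i : ℕ} {y : R i}
    (hy : trans t 0 i i.zero_le g * y = 0) :
    ∃ x, trans t 0 (i + 1) (i + 1).zero_le g * x = 0 ∧ x ^ p = t i y := by
  obtain ⟨G, hG, hF⟩ := h.exists_torsion_bijection i
  obtain ⟨⟨x, hx'⟩, hGx⟩ := hG.2 ⟨y, (h.mem_idealTorsion_iff i y).2 hy⟩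
  have hx := (h.mem_idealTorsion_iff _ _).1 hx'
  have hd := h.purelyInseparable.dvd_sub_pow_of_frobProj_eq (hF ⟨x, hx'⟩).symm
  rw [hGx] at hd
  refine ⟨x, hx, (sub_eq_zero.1 (h.eq_zero_of_dvd_of_mul_eq_zero hd ?_)).symm⟩
  obtain ⟨q, hq⟩ := Nat.exists_eq_succ_of_ne_zero (Fact.out : p.Prime).ne_zero
  rw [mul_sub, mul_map_eq_zero hy, hq, pow_succ', ← mul_assoc, hx, zero_mul, sub_zero]

theorem eq_zero_of_mul_eq_zero_of_pow_eq_zero (h : IsPerfectoid p t (Ideal.span {g})) {i : ℕ}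
    {x : R (i + 1)} (hx : trans t 0 (i + 1) (i + 1).zero_le g * x = 0) (hxp : x ^ p = 0) :
    x = 0 := by
  obtain ⟨G, hG, hF⟩ := h.exists_torsion_bijection i
  have key (y : idealTorsion (trans t 0 (i + 1) (i + 1).zero_le) (Ideal.span {g}))
      (hy : (y : R (i + 1)) ^ p = 0) : (G y : R i) = 0 := by
    have hd := h.purelyInseparable.dvd_sub_pow_of_frobProj_eq (hF y).symm
    rw [hy, sub_zero] at hd
    refine h.eq_zero_of_dvd_of_mul_eq_zero ?_ ((h.mem_idealTorsion_iff i _).1 (G y).2)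
    refine h.purelyInseparable.dvd_of_dvd_trans i.le_succ ?_
    rwa [trans_succ t i i le_rfl, trans_self]
  -- G is only a bijection of sets, so G 0 = 0 needs this argument as well.
  have h0 := key 0 (zero_pow (Fact.out : p.Prime).ne_zero)
  have h1 := key ⟨x, (h.mem_idealTorsion_iff _ _).2 hx⟩ hxp
  exact congrArg Subtype.val (hG.1 (Subtype.ext (h1.trans h0.symm)))

theorem exists_toLimit_eq_of_sq_mul_eq_zero (h : IsPerfectoid p t (Ideal.span {g})) {a : Limit t}
    (ha : toLimit t 0 g ^ 2 * a = 0) :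
    ∃ i x, toLimit t i x = a ∧ trans t 0 i i.zero_le g * x = 0 := by
  obtain ⟨i, -, x, rfl⟩ := exists_toLimit_eq a 0
  rw [← toLimit_trans 0 i i.zero_le, ← map_pow, ← map_mul] at ha
  obtain ⟨j, hij, hj⟩ := exists_trans_eq_zero ha
  rw [map_mul, map_pow, trans_trans_apply] at hj
  exact ⟨j, _, toLimit_trans i j hij x, h.mul_eq_zero_of_sq_mul_eq_zero hj⟩

theorem exists_pow_eq_of_sq_mul_eq_zero (h : IsPerfectoid p t (Ideal.span {g})) {a : Limit t}
    (ha : toLimit t 0 g ^ 2 * a = 0) : ∃ b, toLimit t 0 g * b = 0 ∧ b ^ p = a := by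
  obtain ⟨i, y, rfl, hy⟩ := h.exists_toLimit_eq_of_sq_mul_eq_zero ha
  obtain ⟨x, hx, hxp⟩ := h.exists_pow_eq_of_mul_eq_zero hy
  refine ⟨toLimit t (i + 1) x, ?_, ?_⟩
  · rw [← toLimit_trans 0 (i + 1) (i + 1).zero_le, ← map_mul, hx, map_zero]
  · rw [← map_pow, hxp, toLimit_succ]

theorem eq_zero_of_sq_mul_eq_zero_of_pow_eq_zero (h : IsPerfectoid p t (Ideal.span {g}))
    {a : Limit t} (ha : toLimit t 0 g ^ 2 * a = 0) (hap : a ^ p = 0) : a = 0 := by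
  obtain ⟨i, x, rfl, hx⟩ := h.exists_toLimit_eq_of_sq_mul_eq_zero ha
  rw [← map_pow] at hap
  obtain ⟨j, hij, hj⟩ := exists_trans_eq_zero hap
  have hz : trans t 0 j j.zero_le g * trans t i j hij x = 0 := by
    rw [← trans_trans_apply i.zero_le hij, ← map_mul, hx, map_zero]
  -- Reducedness of the torsion is known only at positive stages, hence the move to j + 1.
  have h0 := h.eq_zero_of_mul_eq_zero_of_pow_eq_zero (mul_map_eq_zero hz) (by
    rw [← map_pow, ← map_pow, hj, map_zero])
  rw [← toLimit_trans i j hij, ← toLimit_succ, h0, map_zero]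

theorem isPrePerfectoid_limit (h : IsPerfectoid p t (Ideal.span {g})) {f : R 1}
    (h₁ : IsFirstPillar h.purelyInseparable (Ideal.span {f})) :
    IsPrePerfectoid p (toLimit t 1 f) := by
  have hp := (Fact.out : p.Prime)
  have hpow := h₁.pow_eq
  rw [ext, Ideal.map_span, Set.image_singleton, Ideal.span_singleton_pow] at hpow
  have hgf : trans t 0 1 zero_le_one g ∣ f ^ p := by
    rw [← Ideal.mem_span_singleton, ← hpow]
    exact Ideal.mem_span_singleton_self _
  have hfg : f ^ p ∣ trans t 0 1 zero_le_one g := by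
    rw [← Ideal.mem_span_singleton, hpow]
    exact Ideal.mem_span_singleton_self _
  have hXϖ : toLimit t 0 g ∣ toLimit t 1 f ^ p := by
    rw [← toLimit_trans 0 1 zero_le_one, ← map_pow]
    exact map_dvd _ hgf
  have hϖX : toLimit t 1 f ^ p ∣ toLimit t 0 g := by
    rw [← toLimit_trans 0 1 zero_le_one, ← map_pow]
    exact map_dvd _ hfg
  have kill {x y a : Limit t} (hxy : x ∣ y) (hx : x * a = 0) : y * a = 0 := by
    obtain ⟨c, rfl⟩ := hxy
    rw [mul_right_comm, hx, zero_mul]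
  have hϖX' : toLimit t 1 f ^ 2 ∣ toLimit t 0 g := (pow_dvd_pow _ hp.two_le).trans hϖX
  -- The p-th power of ϖa is a multiple of ϖ^p a = 0, and g-torsion is reduced: this sharpens
  -- annihilation by g to annihilation by ϖ.
  have sq (a : Limit t) (ha : toLimit t 0 g * a = 0) : toLimit t 1 f * a = 0 := by
    have hϖa : (toLimit t 1 f * a) ^ p = 0 := by
      obtain ⟨q, hq⟩ := Nat.exists_eq_succ_of_ne_zero hp.ne_zero
      rw [mul_pow, hq, pow_succ' a, ← hq, ← mul_assoc, kill hXϖ ha, zero_mul]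
    refine h.eq_zero_of_sq_mul_eq_zero_of_pow_eq_zero ?_ hϖa
    linear_combination toLimit t 0 g * toLimit t 1 f * ha
  have tors (a : Limit t) (ha : toLimit t 1 f * a = 0) : toLimit t 0 g ^ 2 * a = 0 :=
    kill (((dvd_pow_self _ two_ne_zero).trans hϖX').trans (dvd_pow_self _ two_ne_zero)) ha
  refine ⟨?_, fun a => ?_, fun a ha => ?_, fun a ha => sq a (kill hϖX' ha), fun a ha => ?_,
    fun a ha => h.eq_zero_of_sq_mul_eq_zero_of_pow_eq_zero (tors a ha)⟩
  · have := map_dvd (toLimit t 0) (Ideal.mem_span_singleton.1 h.purelyInseparable.p_mem)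
    rw [map_natCast] at this
    exact hϖX.trans this
  · obtain ⟨i, -, y, rfl⟩ := exists_toLimit_eq a 0
    obtain ⟨x, hx⟩ := h.frobProj_surjective i (Ideal.Quotient.mk _ y)
    obtain ⟨x, rfl⟩ := Ideal.Quotient.mk_surjective x
    refine ⟨toLimit t (i + 1) x, ?_⟩
    have := h.purelyInseparable.dvd_sub_pow_of_frobProj_eq hx
    rw [← h.purelyInseparable.dvd_toLimit_iff, map_sub, toLimit_succ, map_pow] at this
    exact hϖX.trans this
  · obtain ⟨i, hi, x, rfl⟩ := exists_toLimit_eq a 1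
    obtain ⟨i, rfl⟩ := Nat.exists_eq_succ_of_ne_zero (Nat.one_le_iff_ne_zero.1 hi)
    have := h₁.dvd_of_dvd_pow ((dvd_pow_self f hp.ne_zero).trans hfg)
      ((h.purelyInseparable.dvd_toLimit_iff _ _).1 (by
        rw [map_pow]
        exact hXϖ.trans ha))
    rw [← toLimit_trans 1 (i + 1) i.succ_pos]
    exact map_dvd _ this
  · obtain ⟨b, hb, hba⟩ := h.exists_pow_eq_of_sq_mul_eq_zero (tors a ha)
    exact ⟨b, sq b hb, hba⟩

end IsPerfectoid

end

end Tower

/-! ### Compatible systems of p-power roots. -/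

section FrobeniusCompatible

variable {S : Type*} [CommRing S] {p : ℕ} {ϖ : S}

theorem pow_succ_dvd_pow_pow_sub_pow_pow (hϖ : ϖ ∣ (p : S)) {a b : S} (h : ϖ ∣ a - b) (k : ℕ) :
    ϖ ^ (k + 1) ∣ a ^ p ^ k - b ^ p ^ k := by
  have h1 : a ≡ b [SMOD Ideal.span {ϖ}] := by
    rwa [SModEq.sub_mem, Ideal.mem_span_singleton]
  have h2 := SModEq.pow_pow_add_one (Ideal.mem_span_singleton.2 hϖ) h1 (m := k)
  rwa [SModEq.sub_mem, Ideal.span_singleton_pow, Ideal.mem_span_singleton] at h2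

theorem pow_pow_eq_of_forall_pow_eq {s : ℕ → S} (hs : ∀ m, s (m + 1) ^ p = s m) (m k : ℕ) :
    s (m + k) ^ p ^ k = s m := by
  induction k with
  | zero => simp
  | succ k ih => rw [pow_succ', pow_mul, ← add_assoc, hs, ih]

variable [IsAdicComplete (Ideal.span {ϖ}) S]

/-- A congruence modulo ϖ at index m + k becomes one modulo ϖ^(k+1) at index m after raising to the
p^k-th power. -/
theorem eq_of_forall_pow_eq_of_forall_dvd (hϖ : ϖ ∣ (p : S)) {a b : ℕ → S}
    (ha : ∀ m, a (m + 1) ^ p = a m) (hb : ∀ m, b (m + 1) ^ p = b m) (h : ∀ m, ϖ ∣ a m - b m) :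
    a = b := by
  funext m
  refine sub_eq_zero.1 (eq_zero_of_forall_pow_dvd ϖ fun k => ?_)
  rw [← pow_pow_eq_of_forall_pow_eq ha m k, ← pow_pow_eq_of_forall_pow_eq hb m k]
  exact (pow_dvd_pow ϖ k.le_succ).trans (pow_succ_dvd_pow_pow_sub_pow_pow hϖ (h _) k)

/-- A sequence of successive `p`-th roots modulo `ϖ` is congruent modulo `ϖ` to a sequence of
successive `p`-th roots. -/
theorem exists_forall_pow_eq_of_forall_dvd (hϖ : ϖ ∣ (p : S)) (s : ℕ → S)
    (hs : ∀ m, ϖ ∣ s (m + 1) ^ p - s m) :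
    ∃ x : ℕ → S, (∀ m, x (m + 1) ^ p = x m) ∧ ∀ m, ϖ ∣ x m - s m := by
  have h1 (m k : ℕ) : ϖ ^ (k + 1) ∣ s (m + (k + 1)) ^ p ^ (k + 1) - s (m + k) ^ p ^ k := by
    rw [pow_succ' p, pow_mul, ← add_assoc]
    exact pow_succ_dvd_pow_pow_sub_pow_pow hϖ (hs _) k
  -- x_m is the limit of s(m+k)^(p^k) as k grows.
  choose x hx using fun m => exists_limit_of_pow_dvd (ϖ := ϖ) (fun k => s (m + k) ^ p ^ k)
    fun k => (pow_dvd_pow ϖ k.le_succ).trans (h1 m k)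
  refine ⟨x, fun m => sub_eq_zero.1 (eq_zero_of_forall_pow_dvd ϖ fun k => ?_), fun m => ?_⟩
  · have h2 := (hx (m + 1) k).trans (sub_dvd_pow_sub_pow _ _ p)
    have h3 := (pow_dvd_pow ϖ k.le_succ).trans (hx m (k + 1))
    convert dvd_sub h2 h3 using 1
    rw [← pow_mul, ← pow_succ, add_right_comm, add_assoc]
    ring
  · have h2 := hx m 1
    rw [pow_one, pow_one] at h2
    simpa using dvd_add h2 (hs m)

end FrobeniusCompatible

theorem IsPrePerfectoid.eq_zero_of_pow_pow_eq_zero {p : ℕ} (hp : p ≠ 0) {A : Type*} [CommRing A]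
    {ϖ : A} (h : IsPrePerfectoid p ϖ) {a : A} (ha : ϖ * a = 0) {n : ℕ} (hn : a ^ p ^ n = 0) :
    a = 0 := by
  induction n with
  | zero => simpa using hn
  | succ n ih =>
    refine ih (h.torsion_reduced _ ?_ (by rw [← pow_mul, ← pow_succ, hn]))
    obtain ⟨q, hq⟩ := Nat.exists_eq_succ_of_ne_zero (pow_ne_zero n hp)
    rw [hq, pow_succ', ← mul_assoc, ha, zero_mul]

/-! ### Elements of the tilt as root systems in S. -/

namespace PreTilt

variable {S : Type u} [CommRing S] {p : ℕ} [Fact p.Prime] [Fact (¬ IsUnit (p : S))]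
  [IsAdicComplete (Ideal.span {(p : S)}) S]

/-- The untilt of the `p ^ m`-th root. -/
noncomputable def untiltRoot (m : ℕ) : PreTilt S p →* S :=
  untilt.comp ((iterateFrobeniusEquiv (PreTilt S p) p m).symm : PreTilt S p →* PreTilt S p)

theorem untiltRoot_apply (m : ℕ) (x : PreTilt S p) :
    untiltRoot m x = untilt ((iterateFrobeniusEquiv (PreTilt S p) p m).symm x) :=
  rfl

theorem untiltRoot_zero_apply (x : PreTilt S p) : untiltRoot 0 x = untilt x := by
  rw [untiltRoot_apply]
  congr 1
  exact (RingEquiv.symm_apply_eq _).2 (by simp)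

theorem untiltRoot_succ_pow (m : ℕ) (x : PreTilt S p) :
    untiltRoot (m + 1) x ^ p = untiltRoot m x := by
  rw [untiltRoot_apply, untiltRoot_apply, ← map_pow]
  congr 1
  rw [RingEquiv.eq_symm_apply, map_pow, iterateFrobeniusEquiv_def, ← pow_mul, ← pow_succ,
    ← iterateFrobeniusEquiv_def, RingEquiv.apply_symm_apply]

theorem untiltRoot_pow (m : ℕ) (x : PreTilt S p) : untiltRoot m x ^ p ^ m = untilt x := by
  have := pow_pow_eq_of_forall_pow_eq (s := fun m => untiltRoot m x)
    (fun m => untiltRoot_succ_pow m x) 0 m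
  rwa [zero_add, untiltRoot_zero_apply] at this

theorem untiltRoot_pow_pow (m : ℕ) (x : PreTilt S p) : untiltRoot m (x ^ p ^ m) = untilt x := by
  rw [map_pow, untiltRoot_pow]

theorem mk_untiltRoot (m : ℕ) (x : PreTilt S p) :
    Ideal.Quotient.mk (Ideal.span {(p : S)}) (untiltRoot m x) = coeff m x := by
  rw [untiltRoot_apply, mk_untilt_eq_coeff_zero]
  have h (y : PreTilt S p) : coeff m ((iterateFrobeniusEquiv (PreTilt S p) p m) y) = coeff 0 y := by
    rw [iterateFrobeniusEquiv_apply, coe_iterateFrobenius, coeff_iterate_frobenius' y le_rfl,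
      Nat.sub_self]
  rw [← h, RingEquiv.apply_symm_apply]

theorem ext_untiltRoot {x y : PreTilt S p} (h : ∀ m, untiltRoot m x = untiltRoot m y) : x = y :=
  Perfection.ext fun m => by
    have := congrArg (Ideal.Quotient.mk (Ideal.span {(p : S)})) (h m)
    rwa [mk_untiltRoot, mk_untiltRoot] at this

theorem untiltRoot_zero (m : ℕ) : untiltRoot m (0 : PreTilt S p) = 0 := by
  rw [untiltRoot_apply, map_zero]
  exact Perfection.teichmuller_zero

theorem dvd_untiltRoot_sub (m : ℕ) (x y : PreTilt S p) :
    (p : S) ∣ untiltRoot m (x - y) - (untiltRoot m x - untiltRoot m y) := by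
  rw [← Ideal.mem_span_singleton, ← Ideal.Quotient.eq_zero_iff_mem]
  rw [RingHom.map_sub, RingHom.map_sub, mk_untiltRoot, mk_untiltRoot, mk_untiltRoot, map_sub]
  exact sub_self _

theorem exists_untiltRoot_eq (s : ℕ → S) (hs : ∀ m, s (m + 1) ^ p = s m) :
    ∃ z : PreTilt S p, ∀ m, untiltRoot m z = s m := by
  let z : PreTilt S p := ⟨fun m => Ideal.Quotient.mk (Ideal.span {(p : S)}) (s m), fun m => by
    rw [← map_pow, hs]⟩
  refine ⟨z, fun m => ?_⟩
  refine congrFun (eq_of_forall_pow_eq_of_forall_dvd (ϖ := (p : S)) dvd_rfl (a := fun m => untiltRoot m z)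
    (fun m => untiltRoot_succ_pow m z) hs fun m => ?_) m
  rw [← Ideal.mem_span_singleton, ← Ideal.Quotient.eq, mk_untiltRoot]
  rfl

end PreTilt

/-! ### Divisibility, torsion and completeness in the tilt. -/

namespace IsPrePerfectoid

open PreTilt

variable {S : Type u} [CommRing S] {p : ℕ} [Fact p.Prime] [Fact (¬ IsUnit (p : S))]
  [IsAdicComplete (Ideal.span {(p : S)}) S] {π : PreTilt S p}

theorem dvd_natCast {A : Type*} [CommRing A] {ϖ : A} (h : IsPrePerfectoid p ϖ) : ϖ ∣ (p : A) :=
  (dvd_pow_self ϖ (Fact.out : p.Prime).ne_zero).trans h.pow_dvd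

/-- The product is itself torsion, and its p^n-th power is a multiple of π♯a = 0; torsion is
reduced. -/
theorem untiltRoot_mul_eq_zero (h : IsPrePerfectoid p π.untilt) {a : S} (ha : π.untilt * a = 0)
    (n : ℕ) : untiltRoot n π * a = 0 := by
  have hp := (Fact.out : p.Prime).ne_zero
  refine h.eq_zero_of_pow_pow_eq_zero hp (n := n)
    (by linear_combination untiltRoot n π * ha) ?_
  obtain ⟨q, hq⟩ := Nat.exists_eq_succ_of_ne_zero (pow_ne_zero n hp)
  rw [mul_pow, untiltRoot_pow, hq, pow_succ', ← mul_assoc, ha, zero_mul]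

theorem untiltRoot_dvd_untiltRoot (h : IsPrePerfectoid p π.untilt) {x : PreTilt S p}
    (hx : π.untilt ∣ x.untilt) (n : ℕ) : untiltRoot n π ∣ untiltRoot n x := by
  induction n with
  | zero => simpa only [untiltRoot_zero_apply] using hx
  | succ n ih =>
    obtain ⟨c, hc⟩ := ih
    -- With d a p-th root of c modulo (π♯)^p, the p-th power of x^(1/p^(n+1)) - π^(1/p^(n+1)) d
    -- vanishes modulo (π♯)^p, so π♯ divides the difference.
    obtain ⟨d, e, hd⟩ := h.exists_dvd_sub_pow c
    obtain ⟨r, hr⟩ := exists_add_pow_prime_eq (Fact.out : p.Prime)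
      (untiltRoot (n + 1) x - untiltRoot (n + 1) π * d) (untiltRoot (n + 1) π * d)
    rw [sub_add_cancel, mul_pow, untiltRoot_succ_pow, untiltRoot_succ_pow, hc] at hr
    have hdvd : untiltRoot (n + 1) π ∣ π.untilt := by
      rw [← untiltRoot_pow (n + 1)]
      exact dvd_pow_self _ (pow_ne_zero _ (Fact.out : p.Prime).ne_zero)
    have key : π.untilt ∣ untiltRoot (n + 1) x - untiltRoot (n + 1) π * d := by
      refine h.dvd_of_pow_dvd_pow _ ?_
      obtain ⟨v, hv⟩ := h.pow_dvd
      refine ⟨untiltRoot n π * e - v * (untiltRoot (n + 1) x - untiltRoot (n + 1) π * d) *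
        (untiltRoot (n + 1) π * d) * r, ?_⟩
      rw [hv] at hr
      linear_combination untiltRoot n π * hd - hr
    exact (dvd_iff_dvd_of_dvd_sub (hdvd.trans key)).2 (dvd_mul_right _ _)

/-- The kernel of `S♭ → S / ϖ` is generated by `π`. -/
theorem dvd_of_untilt_dvd_untilt (h : IsPrePerfectoid p π.untilt) {x : PreTilt S p}
    (hx : π.untilt ∣ x.untilt) : π ∣ x := by
  choose y hy using h.untiltRoot_dvd_untiltRoot hx
  have hτ (n : ℕ) : π.untilt * (y (n + 1) ^ p - y n) = 0 := by
    obtain ⟨q, hq⟩ := Nat.exists_eq_succ_of_ne_zero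
      (pow_ne_zero n (Fact.out : p.Prime).ne_zero)
    have e : untiltRoot n π * (y (n + 1) ^ p - y n) = 0 := by
      rw [mul_sub, ← hy, ← untiltRoot_succ_pow n π, ← mul_pow, ← hy, untiltRoot_succ_pow, sub_self]
    rw [← untiltRoot_pow n, hq, pow_succ, mul_assoc, e, mul_zero]
  -- The quotients y n are compatible under p-th powers only up to torsion. Each is corrected by a
  -- torsion element, which the roots of π do not see.
  have step (n : ℕ) (z : {z : S // π.untilt * (z - y n) = 0}) :
      ∃ z' : {z : S // π.untilt * (z - y (n + 1)) = 0}, (z' : S) ^ p = z := by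
    obtain ⟨z, hz⟩ := z
    obtain ⟨σ, hσ, hσp⟩ := h.exists_torsion_root (z - y (n + 1) ^ p)
      (by linear_combination hz - hτ n)
    refine ⟨⟨y (n + 1) + σ, by rw [add_sub_cancel_left, hσ]⟩, ?_⟩
    obtain ⟨r, hr⟩ := exists_add_pow_prime_eq (Fact.out : p.Prime) (y (n + 1)) σ
    obtain ⟨v, hv⟩ := h.dvd_natCast
    rw [hv] at hr
    linear_combination hr + hσp + v * y (n + 1) * r * hσ
  choose next hnext using step
  let z : ∀ n, {z : S // π.untilt * (z - y n) = 0} :=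
    fun n => Nat.rec ⟨y 0, by simp⟩ next n
  obtain ⟨w, hw⟩ := exists_untiltRoot_eq (S := S) (p := p) (fun n => (z n).1)
    fun n => hnext n (z n)
  refine ⟨w, ext_untiltRoot fun n => ?_⟩
  rw [map_mul, hw, hy]
  linear_combination -h.untiltRoot_mul_eq_zero (z n).2 n

/-- Repeated torsion p-th roots of a form a point of the tilt, and all roots of π kill them. -/
theorem exists_untilt_eq_of_mul_eq_zero (h : IsPrePerfectoid p π.untilt) {a : S}
    (ha : π.untilt * a = 0) : ∃ x : PreTilt S p, x.untilt = a ∧ π * x = 0 := by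
  choose! r hr hrp using h.exists_torsion_root
  let s : ℕ → S := fun n => r^[n] a
  have hs (n : ℕ) : π.untilt * s n = 0 := by
    induction n with
    | zero => exact ha
    | succ n ih =>
      simp only [s, Function.iterate_succ_apply']
      exact hr _ ih
  obtain ⟨x, hx⟩ := exists_untiltRoot_eq (p := p) s fun n => by
    simp only [s, Function.iterate_succ_apply']
    exact hrp _ (hs n)
  refine ⟨x, by rw [← untiltRoot_zero_apply, hx]; rfl, ext_untiltRoot fun n => ?_⟩
  rw [map_mul, hx, untiltRoot_zero, h.untiltRoot_mul_eq_zero (hs n)]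

theorem isAdicComplete_preTilt (h : IsPrePerfectoid p π.untilt)
    [IsAdicComplete (Ideal.span {π.untilt}) S] : IsAdicComplete (Ideal.span {π}) (PreTilt S p) := by
  refine (isAdicComplete_span_singleton_iff π).2 ⟨fun x hx => ext_untiltRoot fun m => ?_,
    fun f hf => ?_⟩
  · rw [untiltRoot_zero]
    refine eq_zero_of_forall_pow_dvd π.untilt fun n => ?_
    have := map_dvd (untiltRoot m) (hx (p ^ m * n))
    rwa [pow_mul, map_pow, untiltRoot_pow_pow] at this
  · have hf' {m n : ℕ} (hmn : m ≤ n) : π ^ m ∣ f n - f m := by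
      induction n, hmn using Nat.le_induction with
      | base => simp
      | succ n hmn ih =>
        simpa using dvd_add ((pow_dvd_pow π hmn).trans (hf n)) ih
    -- The index p^m is chosen because the p^m-th root of π^(p^m) is π: precision π^(p^m) for f
    -- becomes precision π♯ for its p^m-th root.
    obtain ⟨s, hs, hsf⟩ := exists_forall_pow_eq_of_forall_dvd (ϖ := π.untilt) h.dvd_natCast
      (fun m => untiltRoot m (f (p ^ m))) fun m => by
        rw [untiltRoot_succ_pow]
        have h1 := map_dvd (untiltRoot m)
          (hf' (Nat.pow_le_pow_right (Fact.out : p.Prime).pos m.le_succ))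
        rw [untiltRoot_pow_pow] at h1
        exact (dvd_iff_dvd_of_dvd_sub (h.dvd_natCast.trans (dvd_untiltRoot_sub m _ _))).1 h1
    obtain ⟨z, hz⟩ := exists_untiltRoot_eq s hs
    have hzf (m : ℕ) : π ^ p ^ m ∣ z - f (p ^ m) := by
      have h1 := (dvd_iff_dvd_of_dvd_sub (h.dvd_natCast.trans
        (dvd_untiltRoot_sub m z (f (p ^ m))))).2 (by rw [hz]; exact hsf m)
      rw [untiltRoot_apply] at h1
      have h2 := map_dvd (iterateFrobeniusEquiv (PreTilt S p) p m) (h.dvd_of_untilt_dvd_untilt h1)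
      rwa [RingEquiv.apply_symm_apply, iterateFrobeniusEquiv_def] at h2
    refine ⟨z, fun n => ?_⟩
    have hn : n ≤ p ^ n := (Nat.lt_pow_self (Fact.out : p.Prime).one_lt).le
    simpa using dvd_add ((pow_dvd_pow π hn).trans (hzf n)) (hf' hn)

end IsPrePerfectoid

/-! ### Convergence of Teichmüller series. -/

namespace WittVector

variable {p : ℕ} [Fact p.Prime] {k : Type*} [CommRing k] {π : k}

theorem map_mk_teichmuller_pow (n : ℕ) :
    WittVector.map (Ideal.Quotient.mk (Ideal.span {π ^ n})) (teichmuller p π ^ n) = 0 := by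
  rw [← map_pow, map_teichmuller,
    Ideal.Quotient.eq_zero_iff_mem.2 (Ideal.mem_span_singleton_self _), teichmuller_zero]

theorem map_mk_eq_iff (n : ℕ) (a b : WittVector p k) :
    WittVector.map (Ideal.Quotient.mk (Ideal.span {π ^ n})) a =
      WittVector.map (Ideal.Quotient.mk (Ideal.span {π ^ n})) b ↔
    ∀ i, π ^ n ∣ a.coeff i - b.coeff i := by
  simp only [WittVector.ext_iff, map_coeff, Ideal.Quotient.eq, Ideal.mem_span_singleton]

variable [IsAdicComplete (Ideal.span {π}) k]

theorem eq_zero_of_forall_map_mk_eq_zero (π : k) [IsAdicComplete (Ideal.span {π}) k]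
    {a : WittVector p k}
    (h : ∀ n, WittVector.map (Ideal.Quotient.mk (Ideal.span {π ^ n})) a = 0) : a = 0 := by
  ext i
  rw [zero_coeff]
  refine eq_zero_of_forall_pow_dvd π fun n => ?_
  have := (map_mk_eq_iff n a 0).1 (by rw [h, map_zero]) i
  rwa [zero_coeff, sub_zero] at this

/-- Series in powers of the Teichmüller representative `[π]` converge, coefficientwise. -/
theorem exists_teichmuller_series_limit (π : k) [IsAdicComplete (Ideal.span {π}) k]
    (c : ℕ → WittVector p k) :
    ∃ L, ∀ n, WittVector.map (Ideal.Quotient.mk (Ideal.span {π ^ n})) L =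
      WittVector.map (Ideal.Quotient.mk (Ideal.span {π ^ n}))
        (∑ j ∈ Finset.range n, teichmuller p π ^ j * c j) := by
  have h (i n : ℕ) : π ^ n ∣
      (∑ j ∈ Finset.range (n + 1), teichmuller p π ^ j * c j).coeff i -
      (∑ j ∈ Finset.range n, teichmuller p π ^ j * c j).coeff i := by
    refine (map_mk_eq_iff n _ _).1 ?_ i
    rw [Finset.sum_range_succ, map_add, map_mul, map_mk_teichmuller_pow, zero_mul, add_zero]
  choose L hL using fun i => exists_limit_of_pow_dvd (ϖ := π)
    (fun n => (∑ j ∈ Finset.range n, teichmuller p π ^ j * c j).coeff i) (h i)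
  exact ⟨WittVector.mk p L, fun n => (map_mk_eq_iff n _ _).2 fun i => hL i n⟩

end WittVector

/-! ### The kernel of θ. -/

namespace IsPrePerfectoid

open PreTilt WittVector

variable {S : Type u} [CommRing S] {p : ℕ} [Fact p.Prime] [Fact (¬ IsUnit (p : S))]
  [IsAdicComplete (Ideal.span {(p : S)}) S] {π : PreTilt S p}

theorem exists_eq_add_teichmuller_mul (h : IsPrePerfectoid p π.untilt)
    {x : WittVector p (PreTilt S p)}
    (hx : (p : S) = π.untilt * fontaineTheta S p x) {a : WittVector p (PreTilt S p)}
    (ha : fontaineTheta S p a = 0) :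
    ∃ c a', a = (p - teichmuller p π * x) * c + teichmuller p π * a' ∧
      fontaineTheta S p a' = 0 := by
  obtain ⟨y, hy⟩ := h.dvd_of_untilt_dvd_untilt (x := a.coeff 0) (h.dvd_natCast.trans (by
    rw [← Ideal.mem_span_singleton, ← Ideal.Quotient.eq_zero_iff_mem, mk_untilt_eq_coeff_zero,
      ← mk_fontaineTheta, ha, map_zero]))
  have h0 : (a - teichmuller p (π * y)).coeff 0 = 0 := by
    refine (map_sub (constantCoeff (p := p)) a (teichmuller p (π * y))).trans ?_
    rw [constantCoeff_apply, constantCoeff_apply, teichmuller_coeff_zero, hy, sub_self]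
  obtain ⟨c, hc⟩ := Ideal.mem_span_singleton.1 ((mem_span_p_iff_coeff_zero_eq_zero _).2 h0)
  rw [map_mul] at hc
  -- Here a = [πy] + pc, and p is rewritten as ξ + [π]x.
  have hd : a = (p - teichmuller p π * x) * c +
      teichmuller p π * (x * c + teichmuller p y) := by
    linear_combination hc
  have hθd : π.untilt * fontaineTheta S p (x * c + teichmuller p y) = 0 := by
    have := congrArg (fontaineTheta S p) hd
    rw [ha, map_add, map_mul, map_sub, map_mul, map_natCast, fontaineTheta_teichmuller, ← hx,
      sub_self, zero_mul, zero_add, map_mul, fontaineTheta_teichmuller] at this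
    exact this.symm
  -- Subtracting [τ] removes the torsion θ-value without changing the product with [π].
  obtain ⟨τ, hτ, hπτ⟩ := h.exists_untilt_eq_of_mul_eq_zero hθd
  have hz : teichmuller p π * teichmuller p τ = 0 := by
    rw [← map_mul, hπτ, teichmuller_zero]
  refine ⟨c, x * c + teichmuller p y - teichmuller p τ, ?_, ?_⟩
  · linear_combination hd + hz
  · rw [map_sub, fontaineTheta_teichmuller, hτ, sub_self]

theorem isPrincipal_ker_fontaineTheta_of_untilt (h : IsPrePerfectoid p π.untilt)
    [IsAdicComplete (Ideal.span {π.untilt}) S] (hθ : Function.Surjective (fontaineTheta S p)) :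
    (RingHom.ker (fontaineTheta S p)).IsPrincipal := by
  obtain ⟨v, hv⟩ := h.dvd_natCast
  obtain ⟨x, rfl⟩ := hθ v
  refine ⟨p - teichmuller p π * x, le_antisymm (fun a ha => ?_) ?_⟩
  · have := h.isAdicComplete_preTilt
    choose c next hc hnext using
      fun a : {a // fontaineTheta S p a = 0} => h.exists_eq_add_teichmuller_mul hv a.2
    let s : ℕ → {a // fontaineTheta S p a = 0} :=
      fun n => (fun a => ⟨next a, hnext a⟩)^[n] ⟨a, ha⟩
    have hs (n : ℕ) : (s n : WittVector p (PreTilt S p)) =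
        (p - teichmuller p π * x) * c (s n) + teichmuller p π * s (n + 1) := by
      simp only [s, Function.iterate_succ_apply']
      exact hc _
    have hsum (n : ℕ) : a = (p - teichmuller p π * x) *
        (∑ j ∈ Finset.range n, teichmuller p π ^ j * c (s j)) + teichmuller p π ^ n * s n := by
      induction n with
      | zero => simp [s]
      | succ n ih =>
        rw [Finset.sum_range_succ]
        linear_combination ih + teichmuller p π ^ n * hs n
    obtain ⟨L, hL⟩ := exists_teichmuller_series_limit π fun j => c (s j)
    refine Ideal.mem_span_singleton'.2 ⟨L, ?_⟩
    refine sub_eq_zero.1 (eq_zero_of_forall_map_mk_eq_zero π fun n => ?_)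
    conv_lhs => rw [hsum n]
    rw [map_sub, map_mul, hL, map_add, map_mul, map_mul, map_mk_teichmuller_pow]
    ring
  · rw [Submodule.span_singleton_le_iff_mem, RingHom.mem_ker, map_sub, map_mul, map_natCast,
      fontaineTheta_teichmuller, ← hv, sub_self]

theorem isPrincipal_ker_fontaineTheta {ϖ : S} (h : IsPrePerfectoid p ϖ)
    [IsAdicComplete (Ideal.span {ϖ}) S]
    (hF : Function.Surjective (fun x : S ⧸ Ideal.span {(p : S)} => x ^ p)) :
    (RingHom.ker (fontaineTheta S p)).IsPrincipal := by
  obtain ⟨π, hπ⟩ := Perfection.coeff_surjective (R := ModP S p) (p := p) hF 0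
    (Ideal.Quotient.mk _ ϖ)
  obtain ⟨π, rfl⟩ : ∃ π' : PreTilt S p, π' = π := ⟨π, rfl⟩
  have hdvd : (p : S) ∣ untilt π - ϖ := by
    rw [← Ideal.mem_span_singleton, ← Ideal.Quotient.eq, mk_untilt_eq_coeff_zero]
    exact hπ
  have hassoc : Associated ϖ (untilt π) := by
    -- Since ϖ² divides p, the error is ϖ²e, and π♯ = ϖ(1 + ϖe) with a unit factor.
    obtain ⟨e, he⟩ := (pow_dvd_pow ϖ (Fact.out : p.Prime).two_le).trans (h.pow_dvd.trans hdvd)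
    obtain ⟨w, hw⟩ := isUnit_one_add_mul (ϖ := ϖ) e
    exact ⟨w, by rw [hw]; linear_combination -he⟩
  have : IsAdicComplete (Ideal.span {untilt π}) S :=
    isAdicComplete_span_singleton_of_dvd hassoc.dvd
  exact (h.of_associated hassoc).isPrincipal_ker_fontaineTheta_of_untilt
    (surjective_fontaineTheta hF)

end IsPrePerfectoid

theorem IsPrePerfectoid.isPerfectoidRing {p : ℕ} [Fact p.Prime] {S : Type u} [CommRing S] {ϖ : S}
    (h : IsPrePerfectoid p ϖ) [IsAdicComplete (Ideal.span {ϖ}) S] : IsPerfectoidRing p S := by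
  have hF : Function.Surjective (fun x : S ⧸ Ideal.span {(p : S)} => x ^ p) := fun a => by
    obtain ⟨a, rfl⟩ := Ideal.Quotient.mk_surjective a
    obtain ⟨b, hb⟩ := exists_dvd_sub_pow_of_pow_dvd (Fact.out : p.Prime) h.exists_dvd_sub_pow a
    refine ⟨Ideal.Quotient.mk _ b, ?_⟩
    rw [← Ideal.mem_span_singleton, ← Ideal.Quotient.eq, map_pow] at hb
    exact hb.symm
  refine ⟨⟨ϖ, h.pow_dvd, ‹_›⟩, hF, ?_⟩
  intro _
  have := isAdicComplete_span_singleton_of_dvd (ϖ := ϖ) h.dvd_natCast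
  exact ⟨this, h.isPrincipal_ker_fontaineTheta hF⟩

theorem corollary3p34 (p : ℕ) [Fact p.Prime] {R : ℕ → Type u} [∀ i, CommRing (R i)]
    (t : ∀ i, R i →+* R (i + 1)) (I₀ : Ideal (R 0)) (h : Tower.IsPerfectoid p t I₀)
    (I₁ : Ideal (R 1)) (h₁ : Tower.IsFirstPillar h.purelyInseparable I₁) :
    IsPerfectoidRing p (AdicCompletion (I₁.map (Tower.toLimit t 1)) (Tower.Limit t)) := by
  obtain ⟨g, rfl⟩ : ∃ g, I₀ = Ideal.span {g} := h.isPrincipal.principal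
  obtain ⟨f, rfl⟩ : ∃ f, I₁ = Ideal.span {f} := h₁.isPrincipal.principal
  rw [Ideal.map_span, Set.image_singleton]
  have := isAdicComplete_adicCompletion (Tower.toLimit t 1 f)
  exact ((h.isPrePerfectoid_limit h₁).adicCompletion
    (Fact.out : p.Prime).ne_zero).isPerfectoidRing
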